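/- Let $\mathcal E$ be a complex Hilbert space, and let $H^2_{\mathcal E}(\mathbb D)$ be the Hilbert space of functions $f(z)=\sum_{n\ge 0} a_n z^n$ on the open unit disc $\mathbb D$ with $a_n\in\mathcal E$ and $\|f\|^2=\sum_{n\ge 0}\|a_n\|^2<\infty$. Let $\Phi\in H^\infty_{\mathcal B(\mathcal E)}(\mathbb D)$, that is, $\Phi:\mathbb D\to\mathcal B(\mathcal E)$ is a bounded analytic function, and suppose that $\|\Phi\|_\infty=\sup_{z\in\mathbb D}\|\Phi(z)\|\le 1$ and that $\Phi(0)$ is an isometry on $\mathcal E$. Let $M_\Phi$ be the bounded operator on $H^2_{\mathcal E}(\mathbb D)$ given by $(M_\Phi f)(z)=\Phi(z)f(z)$. Then exactly one of the following holds: 1. $M_\Phi$ has a unitary part, that is, there is a non-zero closed subspace $\mathcal M\subseteq H^2_{\mathcal E}(\mathbb D)$ such that $\mathcal M$ and $\mathcal M^\perp$ are $M_\Phi$-invariant and $M_\Phi|_{\mathcal M}:\mathcal M\to\mathcal M$ is unitary; 2. $M_\Phi$ is a $C_{\cdot 0}$-contraction, that is, $\|M_\Phi\|\le 1$ and $M_\Phi^{*n}f\to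 0$ as $n\to\infty$ for every $f\in H^2_{\mathcal E}(\mathbb D)$. -/

import Mathlib

open Filter Topology Metric
open scoped Complex.UnitDisc InnerProductSpace

namespace HardyAux
variable {E : Type*} [NormedAddCommGroup E] [InnerProductSpace ℂ E]

theorem norm_exp_pow (θ : ℝ) (n : ℕ) : ‖Complex.exp (θ * Complex.I) ^ n‖ = 1 := by
  rw [norm_pow, Complex.norm_exp_ofReal_mul_I, one_pow]

theorem integral_inner_exp (u v : E) (m n : ℕ) :
    ∫ θ in (0 : ℝ)..(2 * Real.pi), inner ℂ (Complex.exp (θ * Complex.I) ^ m • u)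
      (Complex.exp (θ * Complex.I) ^ n • v) = if m = n then 2 * Real.pi * inner ℂ u v else 0 := by
  have key : ∀ θ : ℝ, inner ℂ (Complex.exp (θ * Complex.I) ^ m • u)
      (Complex.exp (θ * Complex.I) ^ n • v)
      = Complex.exp ((((n : ℂ) - m) * Complex.I) * θ) * inner ℂ u v := by
    intro θ
    rw [inner_smul_left, inner_smul_right, ← mul_assoc, map_pow, ← Complex.exp_conj,
      ← Complex.exp_nat_mul, ← Complex.exp_nat_mul, ← Complex.exp_add]
    congr 2
    simp
    ring
  simp_rw [key]
  rw [intervalIntegral.integral_mul_const]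
  split_ifs with h
  · subst h; simp
  · have hc : ((n : ℂ) - m) * Complex.I ≠ 0 := by
      refine mul_ne_zero (sub_ne_zero.2 ?_) Complex.I_ne_zero
      exact fun h' => h (Nat.cast_injective h').symm
    rw [integral_exp_mul_complex hc]
    have : Complex.exp (((n : ℂ) - m) * Complex.I * ((2 * Real.pi : ℝ) : ℂ)) = 1 := by
      rw [Complex.exp_eq_one_iff]
      exact ⟨(n : ℤ) - m, by push_cast; ring⟩
    rw [this]; simp

theorem summable_norm_of_disc {a : ℕ → E} {f : 𝔻 → E}
    (h : ∀ z : 𝔻, HasSum (fun n => (z : ℂ) ^ n • a n) (f z)) {r : ℝ} (hr0 : 0 ≤ r) (hr : r < 1) :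
    Summable fun n => ‖(r : ℂ) ^ n • a n‖ := by
  obtain ⟨s, hrs, hs⟩ := exists_between hr
  have hs0 : 0 < s := hr0.trans_lt hrs
  have hsn : ‖(s : ℂ)‖ < 1 := by rwa [Complex.norm_real, Real.norm_of_nonneg hs0.le]
  have ht := (h (Complex.UnitDisc.mk s hsn)).summable.tendsto_atTop_zero.norm
  obtain ⟨C, hC⟩ := ht.bddAbove_range
  have hC' : ∀ n, s ^ n * ‖a n‖ ≤ C := fun n => by
    have := hC ⟨n, rfl⟩
    simpa [norm_smul, abs_of_pos hs0] using this
  refine Summable.of_nonneg_of_le (fun n => norm_nonneg _) (fun n => ?_)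
    ((summable_geometric_of_lt_one (div_nonneg hr0 hs0.le) ((div_lt_one hs0).2 hrs)).mul_left C)
  have : ‖(r : ℂ) ^ n • a n‖ = (s ^ n * ‖a n‖) * (r / s) ^ n := by
    rw [norm_smul, norm_pow, Complex.norm_real, Real.norm_of_nonneg hr0, div_pow]
    field_simp
  rw [this]
  exact mul_le_mul_of_nonneg_right (hC' n) (by positivity)

theorem summable_norm_of_sq {a : ℕ → E} (ha : Summable fun n => ‖a n‖ ^ 2) (z : 𝔻) :
    Summable fun n => ‖(z : ℂ) ^ n • a n‖ := by
  have h1 : Summable fun n => (‖(z : ℂ)‖ ^ 2) ^ n :=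
    summable_geometric_of_lt_one (by positivity) z.sq_norm_lt_one
  refine Summable.of_nonneg_of_le (fun n => norm_nonneg _) (fun n => ?_) (h1.add ha)
  rw [norm_smul, norm_pow, ← pow_mul, mul_comm 2 n, pow_mul]
  nlinarith [sq_nonneg (‖(z : ℂ)‖ ^ n), sq_nonneg (‖a n‖), sq_nonneg (‖(z : ℂ)‖ ^ n - ‖a n‖)]

variable [CompleteSpace E]

/-- Parseval's identity for an absolutely convergent vector-valued Fourier series. -/
theorem hasSum_norm_sq_of_circle (b : ℕ → E) (hb : Summable fun n => ‖b n‖) (g : ℝ → E)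
    (hg : ∀ θ : ℝ, HasSum (fun n => Complex.exp (θ * Complex.I) ^ n • b n) (g θ)) :
    Continuous g ∧
    HasSum (fun n => 2 * Real.pi * ‖b n‖ ^ 2) (∫ θ in (0 : ℝ)..(2 * Real.pi), ‖g θ‖ ^ 2) := by
  have hn : ∀ (θ : ℝ) (n : ℕ), ‖Complex.exp (θ * Complex.I) ^ n • b n‖ = ‖b n‖ := by
    intro θ n; rw [norm_smul, norm_exp_pow, one_mul]
  have hcont : Continuous g := by
    have : g = fun θ : ℝ => ∑' n, Complex.exp (θ * Complex.I) ^ n • b n :=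
      funext fun θ => (hg θ).tsum_eq.symm
    rw [this]
    exact continuous_tsum (fun n => by fun_prop) hb (fun n θ => (hn θ n).le)
  refine ⟨hcont, ?_⟩
  have hgn : ∀ θ, ‖g θ‖ ≤ ∑' n, ‖b n‖ := fun θ => by
    rw [← (hg θ).tsum_eq]
    exact tsum_of_norm_bounded hb.hasSum fun n => (hn θ n).le
  have h1 : ∀ n, ∫ θ in (0 : ℝ)..(2 * Real.pi), inner ℂ (g θ)
      (Complex.exp (θ * Complex.I) ^ n • b n) = 2 * Real.pi * (‖b n‖ : ℂ) ^ 2 := by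
    intro n
    have := intervalIntegral.hasSum_integral_of_dominated_convergence
      (μ := MeasureTheory.volume) (a := 0) (b := 2 * Real.pi)
      (F := fun m (θ : ℝ) => (inner ℂ (Complex.exp (θ * Complex.I) ^ m • b m)
        (Complex.exp (θ * Complex.I) ^ n • b n) : ℂ))
      (f := fun θ => inner ℂ (g θ) (Complex.exp (θ * Complex.I) ^ n • b n))
      (fun m _ => ‖b m‖ * ‖b n‖)
      (fun m => by
        refine Continuous.aestronglyMeasurable ?_
        fun_prop)
      (fun m => Eventually.of_forall fun θ _ => by
        refine (norm_inner_le_norm _ _).trans ?_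
        rw [hn, hn])
      (Eventually.of_forall fun θ _ => hb.mul_right _)
      (by simp)
      (Eventually.of_forall fun θ _ => by
        have := (hg θ).mapL ((innerSLFlip ℂ) (Complex.exp (θ * Complex.I) ^ n • b n))
        simpa [mul_comm] using this)
    simp_rw [integral_inner_exp] at this
    rw [← this.tsum_eq, tsum_ite_eq, inner_self_eq_norm_sq_to_K]
    simp
  have := intervalIntegral.hasSum_integral_of_dominated_convergence
      (μ := MeasureTheory.volume) (a := 0) (b := 2 * Real.pi)
      (F := fun n (θ : ℝ) => (inner ℂ (g θ)
        (Complex.exp (θ * Complex.I) ^ n • b n) : ℂ))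
      (f := fun θ => inner ℂ (g θ) (g θ))
      (fun n _ => (∑' n, ‖b n‖) * ‖b n‖)
      (fun m => by
        refine Continuous.aestronglyMeasurable ?_
        fun_prop)
      (fun m => Eventually.of_forall fun θ _ => by
        refine (norm_inner_le_norm _ _).trans ?_
        rw [hn]
        exact mul_le_mul_of_nonneg_right (hgn θ) (norm_nonneg _))
      (Eventually.of_forall fun θ _ => hb.mul_left _)
      (by simp)
      (Eventually.of_forall fun θ _ => by
        have := (hg θ).mapL (innerSL ℂ (g θ))
        simpa using this)
  simp_rw [h1, inner_self_eq_norm_sq_to_K] at this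
  have h2 : ∫ θ in (0 : ℝ)..(2 * Real.pi), ((‖g θ‖ : ℂ)) ^ 2
      = ((∫ θ in (0 : ℝ)..(2 * Real.pi), ‖g θ‖ ^ 2 : ℝ) : ℂ) := by
    rw [← intervalIntegral.integral_ofReal]
    simp
  rw [← Complex.hasSum_ofReal]
  simp only [Complex.coe_algebraMap] at this
  rw [h2] at this
  have h3 : (fun n => ((2 * Real.pi * ‖b n‖ ^ 2 : ℝ) : ℂ))
      = fun n => 2 * (Real.pi : ℂ) * (‖b n‖ : ℂ) ^ 2 := by
    funext n; push_cast; ring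
  rw [h3]
  exact this


theorem circle_mem {r : ℝ} (hr0 : 0 ≤ r) (hr : r < 1) (θ : ℝ) :
    ‖(r : ℂ) * Complex.exp (θ * Complex.I)‖ < 1 := by
  rw [norm_mul, Complex.norm_exp_ofReal_mul_I, mul_one, Complex.norm_real,
    Real.norm_of_nonneg hr0]
  exact hr

/-- Parseval's identity on the circle of radius `r < 1`. -/
theorem hasSum_of_disc {a : ℕ → E} {f : 𝔻 → E}
    (h : ∀ z : 𝔻, HasSum (fun n => (z : ℂ) ^ n • a n) (f z)) {r : ℝ} (hr0 : 0 ≤ r) (hr : r < 1) :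
    Continuous (fun θ : ℝ => f (Complex.UnitDisc.mk _ (circle_mem hr0 hr θ))) ∧
    HasSum (fun n => 2 * Real.pi * (r ^ n * ‖a n‖) ^ 2)
      (∫ θ in (0 : ℝ)..(2 * Real.pi),
        ‖f (Complex.UnitDisc.mk _ (circle_mem hr0 hr θ))‖ ^ 2) := by
  have := hasSum_norm_sq_of_circle (fun n => (r : ℂ) ^ n • a n) (summable_norm_of_disc h hr0 hr)
    (fun θ => f (Complex.UnitDisc.mk _ (circle_mem hr0 hr θ))) (fun θ => by
      have := h (Complex.UnitDisc.mk _ (circle_mem hr0 hr θ))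
      simpa [mul_pow, smul_smul, mul_comm] using this)
  simpa [norm_smul, abs_of_nonneg hr0] using this

theorem coeff_eq_of_disc {a b : ℕ → E} {f : 𝔻 → E}
    (ha : ∀ z : 𝔻, HasSum (fun n => (z : ℂ) ^ n • a n) (f z))
    (hb : ∀ z : 𝔻, HasSum (fun n => (z : ℂ) ^ n • b n) (f z)) : a = b := by
  have hab : ∀ z : 𝔻, HasSum (fun n => (z : ℂ) ^ n • (a n - b n)) ((fun _ => (0 : E)) z) := by
    intro z
    simpa [smul_sub] using (ha z).sub (hb z)
  have := (hasSum_of_disc hab (r := 1 / 2) (by norm_num) (by norm_num)).2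
  simp only [norm_zero, ne_eq, OfNat.ofNat_ne_zero, not_false_eq_true, zero_pow,
    intervalIntegral.integral_zero] at this
  rw [hasSum_zero_iff_of_nonneg (fun n => by positivity)] at this
  funext n
  have h1 := congrFun this n
  simpa [sub_eq_zero, Real.pi_ne_zero] using h1

theorem differentiableOn_powerSeries {a : ℕ → E} {f : 𝔻 → E}
    (h : ∀ z : 𝔻, HasSum (fun n => (z : ℂ) ^ n • a n) (f z)) :
    DifferentiableOn ℂ (fun z : ℂ => ∑' n, z ^ n • a n) (ball 0 1) := by
  intro z hz
  obtain ⟨r, hzr, hr⟩ := exists_between (mem_ball_zero_iff.1 hz)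
  have hr0 : 0 ≤ r := (norm_nonneg z).trans hzr.le
  have := Complex.differentiableOn_tsum_of_summable_norm (U := ball (0 : ℂ) r)
    (F := fun n (z : ℂ) => z ^ n • a n) (summable_norm_of_disc h hr0 hr)
    (fun n => by fun_prop) isOpen_ball (fun n w hw => by
      rw [norm_smul, norm_smul, norm_pow, norm_pow, Complex.norm_real, Real.norm_of_nonneg hr0]
      gcongr
      exact (mem_ball_zero_iff.1 hw).le)
  exact (this.differentiableAt (isOpen_ball.mem_nhds (mem_ball_zero_iff.2 hzr))).differentiableWithinAt

/-- The product of a bounded analytic operator function with an analytic function with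
square-summable Taylor coefficients again has square-summable Taylor coefficients. -/
theorem exists_coeff_mul {Φ : ℂ → E →L[ℂ] E} (hΦ : DifferentiableOn ℂ Φ (ball 0 1)) {C : ℝ}
    (hC : ∀ z : 𝔻, ‖Φ z‖ ≤ C) {a : ℕ → E} (ha : Summable fun n => ‖a n‖ ^ 2) {f : 𝔻 → E}
    (h : ∀ z : 𝔻, HasSum (fun n => (z : ℂ) ^ n • a n) (f z)) :
    ∃ c : ℕ → E, (Summable fun n => ‖c n‖ ^ 2) ∧
      (∀ z : 𝔻, HasSum (fun n => (z : ℂ) ^ n • c n) (Φ z (f z))) ∧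
      ∑' n, ‖c n‖ ^ 2 ≤ C ^ 2 * ∑' n, ‖a n‖ ^ 2 := by
  have hG : DifferentiableOn ℂ (fun z : ℂ => Φ z (∑' n, z ^ n • a n)) (ball 0 1) :=
    hΦ.clm_apply (differentiableOn_powerSeries h)
  set G : ℂ → E := fun z : ℂ => Φ z (∑' n, z ^ n • a n) with hGdef
  set c : ℕ → E := fun n => (n.factorial : ℂ)⁻¹ • iteratedDeriv n G 0 with hc
  have hcs : ∀ z : 𝔻, HasSum (fun n => (z : ℂ) ^ n • c n) (Φ z (f z)) := by
    intro z
    have := Complex.hasSum_taylorSeries_on_ball hG (mem_ball_zero_iff.2 z.norm_lt_one)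
    have hGz : G z = Φ z (f z) := by rw [hGdef]; simp only [(h z).tsum_eq]
    rw [hGz] at this
    convert this using 2 with n
    rw [hc, sub_zero, smul_comm]
  have hC0 : 0 ≤ C := (norm_nonneg _).trans (hC 0)
  have hfin : ∀ s : Finset ℕ, ∑ n ∈ s, ‖c n‖ ^ 2 ≤ C ^ 2 * ∑' n, ‖a n‖ ^ 2 := by
    intro s
    have hr : ∀ r : ℝ, 0 ≤ r → r < 1 → ∑ n ∈ s, (r ^ n * ‖c n‖) ^ 2 ≤ C ^ 2 * ∑' n, ‖a n‖ ^ 2 := by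
      intro r hr0 hr1
      obtain ⟨hgc, hg⟩ := hasSum_of_disc hcs hr0 hr1
      obtain ⟨hfc, hf⟩ := hasSum_of_disc h hr0 hr1
      have h1 : ∑ n ∈ s, 2 * Real.pi * (r ^ n * ‖c n‖) ^ 2 ≤ _ :=
        sum_le_hasSum s (fun n _ => by positivity) hg
      have h2 : (∫ θ in (0 : ℝ)..(2 * Real.pi),
          ‖Φ ((Complex.UnitDisc.mk _ (circle_mem hr0 hr1 θ) : 𝔻) : ℂ)
            (f (Complex.UnitDisc.mk _ (circle_mem hr0 hr1 θ)))‖ ^ 2) ≤ C ^ 2 * ∫ θ in (0 : ℝ)..(2 * Real.pi),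
          ‖f (Complex.UnitDisc.mk _ (circle_mem hr0 hr1 θ))‖ ^ 2 := by
        rw [← intervalIntegral.integral_const_mul]
        refine intervalIntegral.integral_mono_on (by positivity)
          (Continuous.intervalIntegrable (hgc.norm.pow 2) _ _)
          (Continuous.intervalIntegrable ((hfc.norm.pow 2).const_mul _) _ _) (fun θ _ => ?_)
        rw [← mul_pow]
        exact pow_le_pow_left₀ (norm_nonneg _) (ContinuousLinearMap.le_of_opNorm_le _ (hC _) _) 2
      have h3 : (∫ θ in (0 : ℝ)..(2 * Real.pi),
          ‖f (Complex.UnitDisc.mk _ (circle_mem hr0 hr1 θ))‖ ^ 2)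
          ≤ 2 * Real.pi * ∑' n, ‖a n‖ ^ 2 := by
        refine hasSum_le (fun n => ?_) hf (ha.hasSum.mul_left _)
        have : r ^ n * ‖a n‖ ≤ ‖a n‖ :=
          mul_le_of_le_one_left (norm_nonneg _) (pow_le_one₀ hr0 hr1.le)
        gcongr
      have h4 : 2 * Real.pi * ∑ n ∈ s, (r ^ n * ‖c n‖) ^ 2
          ≤ 2 * Real.pi * (C ^ 2 * ∑' n, ‖a n‖ ^ 2) := by
        rw [Finset.mul_sum]
        refine (h1.trans h2).trans ?_
        calc _ ≤ C ^ 2 * (2 * Real.pi * ∑' n, ‖a n‖ ^ 2) := by gcongr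
          _ = _ := by ring
      exact le_of_mul_le_mul_left h4 (by positivity)
    have hcont : Continuous fun r : ℝ => ∑ n ∈ s, (r ^ n * ‖c n‖) ^ 2 := by fun_prop
    have ht : Tendsto (fun r : ℝ => ∑ n ∈ s, (r ^ n * ‖c n‖) ^ 2) (𝓝[<] 1)
        (𝓝 (∑ n ∈ s, ‖c n‖ ^ 2)) := by
      have := (hcont.tendsto 1).mono_left (nhdsWithin_le_nhds (s := Set.Iio 1))
      simpa using this
    refine le_of_tendsto ht ?_
    filter_upwards [Ioo_mem_nhdsLT (show (0 : ℝ) < 1 by norm_num)] with r hr'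
    exact hr r hr'.1.le hr'.2
  have hsum : Summable fun n => ‖c n‖ ^ 2 :=
    summable_of_sum_le (fun n => by positivity) hfin
  exact ⟨c, hsum, hcs, hsum.tsum_le_of_sum_le hfin⟩

end HardyAux

section HardySpace
variable (E : Type*) [NormedAddCommGroup E] [InnerProductSpace ℂ E]

/-- The functions `f : 𝔻 → E` of the form `f z = ∑ aₙ zⁿ` with `∑ ‖aₙ‖² < ∞`, as a linear
subspace of all functions on the disc. -/
def hardySubmodule : Submodule ℂ (𝔻 → E) where
  carrier := {f | ∃ a : ℕ → E, (Summable fun n => ‖a n‖ ^ 2) ∧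
    ∀ z : 𝔻, HasSum (fun n => (z : ℂ) ^ n • a n) (f z)}
  zero_mem' := ⟨0, by simp [summable_zero], fun z => by simp [hasSum_zero]⟩
  add_mem' := by
    rintro f g ⟨a, ha, haf⟩ ⟨b, hb, hbg⟩
    refine ⟨a + b, ?_, fun z => by simpa using (haf z).add (hbg z)⟩
    refine Summable.of_nonneg_of_le (fun n => by positivity) (fun n => ?_)
      ((ha.mul_left 2).add (hb.mul_left 2))
    have h1 : ‖(a + b) n‖ ≤ ‖a n‖ + ‖b n‖ := norm_add_le _ _
    nlinarith [norm_nonneg ((a + b) n), sq_nonneg (‖a n‖ - ‖b n‖)]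
  smul_mem' := by
    rintro c f ⟨a, ha, haf⟩
    refine ⟨c • a, ?_, fun z => ?_⟩
    · simpa [norm_smul, mul_pow] using ha.mul_left (‖c‖ ^ 2)
    · simpa [smul_comm c] using (haf z).const_smul c

/-- The `E`-valued Hardy space `H²_E(𝔻)` (its elements are functions on the disc). -/
def HardySpace : Type _ := hardySubmodule E

variable {E}

namespace HardySpace

noncomputable instance : AddCommGroup (HardySpace E) := 
  inferInstanceAs (AddCommGroup (hardySubmodule E))

noncomputable instance : Module ℂ (HardySpace E) := inferInstanceAs (Module ℂ (hardySubmodule E))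

instance : FunLike (HardySpace E) 𝔻 E where
  coe f := f.1
  coe_injective := Subtype.val_injective

@[ext] theorem ext {f g : HardySpace E} (h : ∀ z, f z = g z) : f = g := DFunLike.ext _ _ h

@[simp] theorem add_apply (f g : HardySpace E) (z : 𝔻) : (f + g) z = f z + g z := rfl

@[simp] theorem smul_apply (c : ℂ) (f : HardySpace E) (z : 𝔻) : (c • f) z = c • f z := rfl

/-- The Taylor coefficients of `f ∈ H²_E(𝔻)`. -/
noncomputable def coeff (f : HardySpace E) : ℕ → E := f.2.choose

theorem summable_coeff (f : HardySpace E) : Summable fun n => ‖coeff f n‖ ^ 2 :=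
  f.2.choose_spec.1

theorem hasSum_coeff (f : HardySpace E) (z : 𝔻) :
    HasSum (fun n => (z : ℂ) ^ n • coeff f n) (f z) :=
  f.2.choose_spec.2 z

theorem summable_lp {F : Type*} [NormedAddCommGroup F] (a : lp (fun _ : ℕ => F) 2) : Summable fun n => ‖a n‖ ^ 2 := by
  simpa using (lp.memℓp a).summable (by simp)

theorem memlp_coeff (f : HardySpace E) : Memℓp (E := fun _ : ℕ => E) (coeff f) 2 :=
  memℓp_gen (by simpa using summable_coeff f)

variable [CompleteSpace E]

theorem coeff_eq {f : HardySpace E} {a : ℕ → E}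
    (h : ∀ z : 𝔻, HasSum (fun n => (z : ℂ) ^ n • a n) (f z)) : coeff f = a :=
  HardyAux.coeff_eq_of_disc (hasSum_coeff f) h

/-- The function `z ↦ ∑ aₙ zⁿ` for a square-summable sequence `a`. -/
noncomputable def ofCoeff (a : lp (fun _ : ℕ => E) 2) : HardySpace E :=
  ⟨fun z => ∑' n, (z : ℂ) ^ n • a n, a, summable_lp a, fun z =>
    (HardyAux.summable_norm_of_sq (summable_lp a) z).of_norm.hasSum⟩

theorem hasSum_ofCoeff (a : lp (fun _ : ℕ => E) 2) (z : 𝔻) :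
    HasSum (fun n => (z : ℂ) ^ n • a n) (ofCoeff a z) :=
  (HardyAux.summable_norm_of_sq (summable_lp a) z).of_norm.hasSum

theorem coeff_add (f g : HardySpace E) : coeff (f + g) = coeff f + coeff g :=
  coeff_eq fun z => by simpa using (hasSum_coeff f z).add (hasSum_coeff g z)

theorem coeff_smul (c : ℂ) (f : HardySpace E) : coeff (c • f) = c • coeff f :=
  coeff_eq fun z => by simpa [smul_comm c] using (hasSum_coeff f z).const_smul c

/-- `f ↦ (aₙ)ₙ` identifies `H²_E(𝔻)` with the square-summable sequences in `E`. -/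
noncomputable def coeffEquiv : HardySpace E ≃ₗ[ℂ] lp (fun _ : ℕ => E) 2 where
  toFun f := ⟨coeff f, memlp_coeff f⟩
  map_add' f g := lp.ext (coeff_add f g)
  map_smul' c f := lp.ext (coeff_smul c f)
  invFun := ofCoeff
  left_inv f := ext fun z => (hasSum_ofCoeff _ z).unique (hasSum_coeff f z)
  right_inv a := lp.ext (coeff_eq (hasSum_ofCoeff a))

/-- The norm `‖f‖ = (∑ ‖aₙ‖²)^(1/2)`. -/
noncomputable instance : NormedAddCommGroup (HardySpace E) :=
  NormedAddCommGroup.induced (HardySpace E) (lp (fun _ : ℕ => E) 2) coeffEquiv coeffEquiv.injective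

/-- The inner product `⟪f, g⟫ = ∑ ⟪aₙ, bₙ⟫`. -/
noncomputable instance : InnerProductSpace ℂ (HardySpace E) :=
  InnerProductSpace.induced (coeffEquiv (E := E))

instance : CompleteSpace (HardySpace E) := by
  let e : HardySpace E ≃ₗᵢ[ℂ] lp (fun _ : ℕ => E) 2 := ⟨coeffEquiv, fun _ => rfl⟩
  exact (e.toIsometryEquiv.completeSpace_iff).2 inferInstance

theorem norm_sq_eq_tsum (f : HardySpace E) : ‖f‖ ^ 2 = ∑' n, ‖coeff f n‖ ^ 2 := by
  have := lp.norm_rpow_eq_tsum (p := 2) (by simp) (coeffEquiv f)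
  simp only [ENNReal.toReal_ofNat, Real.rpow_ofNat] at this
  exact this

end HardySpace

/-- `Φ ∈ H^∞_{B(E)}(𝔻)`: `Φ` is analytic and bounded on the unit disc. Values of `Φ` outside the
disc are never used. -/
def IsHInfty (Φ : ℂ → E →L[ℂ] E) : Prop :=
  DifferentiableOn ℂ Φ (ball 0 1) ∧ ∃ C : ℝ, ∀ z : 𝔻, ‖Φ z‖ ≤ C

/-- `‖Φ‖_∞ = sup_{z ∈ 𝔻} ‖Φ z‖`. -/
noncomputable def hInftyNorm (Φ : ℂ → E →L[ℂ] E) : ℝ := ⨆ z : 𝔻, ‖Φ z‖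

theorem IsHInfty.norm_le {Φ : ℂ → E →L[ℂ] E} (hΦ : IsHInfty Φ) (z : 𝔻) :
    ‖Φ z‖ ≤ hInftyNorm Φ := by
  obtain ⟨C, hC⟩ := hΦ.2
  exact le_ciSup (f := fun z : 𝔻 => ‖Φ z‖) ⟨C, by rintro _ ⟨w, rfl⟩; exact hC w⟩ z

variable [CompleteSpace E]

/-- The analytic Toeplitz (multiplication) operator `M_Φ` on `H²_E(𝔻)`, `(M_Φ f)(z) = Φ(z) f(z)`. -/
noncomputable def mulOp (Φ : ℂ → E →L[ℂ] E) (hΦ : IsHInfty Φ) : HardySpace E →L[ℂ] HardySpace E :=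
  LinearMap.mkContinuous
    { toFun := fun f => ⟨fun z => Φ z (f z), by
        obtain ⟨c, h1, h2, -⟩ := HardyAux.exists_coeff_mul hΦ.1 hΦ.norm_le f.summable_coeff
          f.hasSum_coeff
        exact ⟨c, h1, h2⟩⟩
      map_add' := fun f g => HardySpace.ext fun z => (Φ z).map_add (f z) (g z)
      map_smul' := fun c f => HardySpace.ext fun z => (Φ z).map_smul c (f z) }
    (hInftyNorm Φ) (fun f => by
      obtain ⟨c, h1, h2, h3⟩ := HardyAux.exists_coeff_mul hΦ.1 hΦ.norm_le f.summable_coeff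
        f.hasSum_coeff
      have h0 : 0 ≤ hInftyNorm Φ := (norm_nonneg _).trans (hΦ.norm_le 0)
      refine le_of_sq_le_sq ?_ (by positivity)
      rw [mul_pow, HardySpace.norm_sq_eq_tsum, HardySpace.norm_sq_eq_tsum,
        HardySpace.coeff_eq h2]
      exact h3)

@[simp] theorem mulOp_apply (Φ : ℂ → E →L[ℂ] E) (hΦ : IsHInfty Φ) (f : HardySpace E) (z : 𝔻) :
    mulOp Φ hΦ f z = Φ z (f z) := rfl

end HardySpace

section Operators
variable {H : Type*} [NormedAddCommGroup H] [InnerProductSpace ℂ H]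

/-- A closed subspace `M` is `T`-reducing if `M` and `Mᗮ` are both `T`-invariant. -/
def IsReducing (T : H →L[ℂ] H) (M : Submodule ℂ H) : Prop :=
  IsClosed (M : Set H) ∧ (∀ x ∈ M, T x ∈ M) ∧ ∀ x ∈ Mᗮ, T x ∈ Mᗮ

/-- `T` has a unitary part: on some non-zero reducing subspace `M`, `T` restricts to a unitary
(a surjective linear isometry) of `M`. -/
def HasUnitaryPart (T : H →L[ℂ] H) : Prop :=
  ∃ M : Submodule ℂ H, M ≠ ⊥ ∧ IsReducing T M ∧ ∃ U : M ≃ₗᵢ[ℂ] M, ∀ x : M, (U x : H) = T x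

/-- `T` is a `C_{·0}` contraction: `‖T‖ ≤ 1` and `T*ⁿ → 0` in the strong operator topology. -/
def IsCDotZeroContraction [CompleteSpace H] (T : H →L[ℂ] H) : Prop :=
  ‖T‖ ≤ 1 ∧ ∀ x : H, Tendsto (fun n : ℕ => (ContinuousLinearMap.adjoint T ^ n) x) atTop (𝓝 0)

end Operators

/-! ### Wold-type dichotomy for an isometry -/

section Isometry
variable {H : Type*} [NormedAddCommGroup H] [InnerProductSpace ℂ H] [CompleteSpace H]

open ContinuousLinearMap (adjoint)

/-! The hypotheses force `Φ` to be constant: for each `x`, the norm of the analytic function `w ↦ Φ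
w x` is maximal at the centre of the disc, and in a strictly convex space the maximum modulus
principle then makes the function itself constant. Hence `M_Φ` applies the isometry `Φ 0` to each
Taylor coefficient, so it is an isometry `T`.

For any isometry `T`, let `N` be the space of vectors with `T*ⁿ x → 0`. It is closed and reduces
`T`. The defect `x - T T* x` lies in `ker T* ⊆ N`, so for `x ∈ Nᗮ` it lies in `N ∩ Nᗮ` and vanishes;
thus `T` is unitary on `Nᗮ`. Either `Nᗮ = 0` and `T` is `C_{·0}`, or `Nᗮ` is a unitary part. Both
cannot happen, because `T*` preserves norms on a unitary part. -/

theorem adjoint_apply_self_of_norm_map {T : H →L[ℂ] H} (hT : ∀ x, ‖T x‖ = ‖x‖) (x : H) :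
    adjoint T (T x) = x := by
  have h := (ContinuousLinearMap.norm_map_iff_adjoint_comp_self T).1 hT
  exact congrArg (fun S : H →L[ℂ] H => S x) h

theorem norm_adjoint_apply_le {T : H →L[ℂ] H} (hT : ‖T‖ ≤ 1) (x : H) :
    ‖adjoint T x‖ ≤ ‖x‖ := by
  have h := (adjoint T).le_of_opNorm_le (c := 1) (by rwa [LinearIsometryEquiv.norm_map]) x
  rwa [one_mul] at h

theorem norm_adjoint_pow_apply_le {T : H →L[ℂ] H} (hT : ‖T‖ ≤ 1) (n : ℕ) (x : H) :
    ‖(adjoint T ^ n) x‖ ≤ ‖x‖ := by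
  induction n generalizing x with
  | zero => simp
  | succ n ih =>
    rw [pow_succ, mul_apply_eq_comp]
    exact (ih _).trans (norm_adjoint_apply_le hT x)

/-- The vectors `x` with `T*ⁿ x → 0`. -/
def adjointStableSubmodule (T : H →L[ℂ] H) : Submodule ℂ H where
  carrier := {x | Tendsto (fun n : ℕ => (adjoint T ^ n) x) atTop (𝓝 0)}
  zero_mem' := by simp
  add_mem' := fun {x y} hx hy => by
    simpa using Tendsto.add (show Tendsto _ _ _ from hx) (show Tendsto _ _ _ from hy)
  smul_mem' := fun c x hx => by
    simpa only [Set.mem_ofPred_eq, map_smul, smul_zero] using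
      Tendsto.const_smul (show Tendsto _ _ _ from hx) c

theorem mem_adjointStableSubmodule {T : H →L[ℂ] H} {x : H} :
    x ∈ adjointStableSubmodule T ↔ Tendsto (fun n : ℕ => (adjoint T ^ n) x) atTop (𝓝 0) :=
  Iff.rfl

/-- The powers `T*ⁿ` are uniformly bounded by `1`, so strong convergence to `0` passes to limits by
an `ε / 2` argument. -/
theorem isClosed_adjointStableSubmodule {T : H →L[ℂ] H} (hT : ‖T‖ ≤ 1) :
    IsClosed (adjointStableSubmodule T : Set H) := by
  refine isClosed_of_closure_subset fun x hx => ?_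
  change Tendsto _ _ _
  rw [Metric.tendsto_atTop]
  intro ε hε
  obtain ⟨y, hy, hxy⟩ := Metric.mem_closure_iff.1 hx (ε / 2) (half_pos hε)
  obtain ⟨N, hN⟩ := Metric.tendsto_atTop.1 (mem_adjointStableSubmodule.1 hy) (ε / 2) (half_pos hε)
  refine ⟨N, fun n hn => ?_⟩
  have h1 := hN n hn
  have h2 := norm_adjoint_pow_apply_le hT n (x - y)
  rw [dist_zero_right] at h1 ⊢
  rw [dist_eq_norm] at hxy
  have h3 : (adjoint T ^ n) x = (adjoint T ^ n) (x - y) + (adjoint T ^ n) y := by simp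
  rw [h3]
  linarith [norm_add_le ((adjoint T ^ n) (x - y)) ((adjoint T ^ n) y)]

/-- Applying `T*` only shifts the sequence `T*ⁿ x` by one index. One direction gives invariance
under `T*`; the other puts `ker T*` inside the subspace and, when `T* T = 1`, gives invariance under
`T`. -/
theorem adjoint_apply_mem_adjointStableSubmodule_iff {T : H →L[ℂ] H} {x : H} :
    adjoint T x ∈ adjointStableSubmodule T ↔ x ∈ adjointStableSubmodule T := by
  rw [mem_adjointStableSubmodule, mem_adjointStableSubmodule,
    ← tendsto_add_atTop_iff_nat (f := fun n : ℕ => (adjoint T ^ n) x) 1]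
  simp only [pow_succ, mul_apply_eq_comp]

/-- Wold's dichotomy: an isometry has a unitary part or is a `C_{·0}` contraction. -/
theorem hasUnitaryPart_or_isCDotZeroContraction {T : H →L[ℂ] H} (hT : ∀ x, ‖T x‖ = ‖x‖) :
    HasUnitaryPart T ∨ IsCDotZeroContraction T := by
  have hT1 : ‖T‖ ≤ 1 := T.opNorm_le_bound zero_le_one fun x => by rw [hT, one_mul]
  have hcl := isClosed_adjointStableSubmodule hT1
  set N := adjointStableSubmodule T with hN
  -- Completeness of `N` gives `Nᗮᗮ = N`, and `N = ⊤` when `Nᗮ = ⊥`.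
  have : CompleteSpace N := hcl.completeSpace_coe
  have hTN : ∀ x ∈ N, T x ∈ N := fun x hx => by
    rw [hN, ← adjoint_apply_mem_adjointStableSubmodule_iff, adjoint_apply_self_of_norm_map hT]
    exact hx
  by_cases hbot : Nᗮ = ⊥
  · right
    refine ⟨hT1, fun x => ?_⟩
    rw [Submodule.orthogonal_eq_bot_iff] at hbot
    exact mem_adjointStableSubmodule.1 (show x ∈ N by rw [hbot]; trivial)
  left
  have hTM : ∀ x ∈ Nᗮ, T x ∈ Nᗮ := fun x hx => by
    rw [Submodule.mem_orthogonal] at hx ⊢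
    intro u hu
    rw [← ContinuousLinearMap.adjoint_inner_left]
    exact hx _ (adjoint_apply_mem_adjointStableSubmodule_iff.2 hu)
  have hTM' : ∀ x ∈ Nᗮ, adjoint T x ∈ Nᗮ := fun x hx => by
    rw [Submodule.mem_orthogonal] at hx ⊢
    intro u hu
    rw [ContinuousLinearMap.adjoint_inner_right]
    exact hx _ (hTN u hu)
  -- The vector `x - T T* x` is killed by `T*`, hence lies in `N`; it also lies in `Nᗮ`, so it is
  -- zero.
  have hsurj : ∀ x ∈ Nᗮ, T (adjoint T x) = x := fun x hx => by
    have h1 : x - T (adjoint T x) ∈ Nᗮ := Nᗮ.sub_mem hx (hTM _ (hTM' x hx))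
    have h2 : x - T (adjoint T x) ∈ N := by
      rw [hN, ← adjoint_apply_mem_adjointStableSubmodule_iff, map_sub,
        adjoint_apply_self_of_norm_map hT, sub_self]
      exact Submodule.zero_mem _
    have h3 := Submodule.inner_right_of_mem_orthogonal h2 h1
    exact (sub_eq_zero.1 (inner_self_eq_zero.1 h3)).symm
  refine ⟨Nᗮ, hbot, ⟨N.isClosed_orthogonal, hTM, ?_⟩, ?_⟩
  · rwa [Submodule.orthogonal_orthogonal]
  · let L : Nᗮ →ₗᵢ[ℂ] Nᗮ :=
      ⟨(T : H →ₗ[ℂ] H).restrict hTM, fun x => hT x⟩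
    exact ⟨LinearIsometryEquiv.ofSurjective L fun y =>
      ⟨⟨adjoint T y, hTM' y y.2⟩, Subtype.ext (hsurj y y.2)⟩, fun _ => rfl⟩

/-- Since `T* T = 1`, the adjoint acts on the unitary part as `U⁻¹`, so `‖T*ⁿ x‖` stays equal to
`‖x‖` there and cannot tend to `0` for `x ≠ 0`. -/
theorem not_isCDotZeroContraction_of_hasUnitaryPart {T : H →L[ℂ] H} (hT : ∀ x, ‖T x‖ = ‖x‖)
    (h : HasUnitaryPart T) : ¬ IsCDotZeroContraction T := by
  rintro ⟨-, h0⟩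
  obtain ⟨M, hM, -, U, hU⟩ := h
  have hadj : ∀ x : M, adjoint T (x : H) = (U.symm x : H) := fun x => by
    conv_lhs => rw [← U.apply_symm_apply x, hU, adjoint_apply_self_of_norm_map hT]
  have hnorm : ∀ (n : ℕ) (x : M), ‖(adjoint T ^ n) (x : H)‖ = ‖(x : H)‖ := fun n => by
    induction n with
    | zero => simp
    | succ n ih =>
      intro x
      rw [pow_succ, mul_apply_eq_comp, hadj, ih]
      exact U.symm.norm_map x
  obtain ⟨x, hx, hx0⟩ := Submodule.exists_mem_ne_zero_of_ne_bot hM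
  have h1 := (h0 x).norm
  simp only [hnorm _ ⟨x, hx⟩, norm_zero] at h1
  exact hx0 (norm_eq_zero.1 (tendsto_nhds_unique tendsto_const_nhds h1))

end Isometry

/-! ### The multiplication operator is an isometry -/

section Multiplication
variable {E : Type*} [NormedAddCommGroup E] [InnerProductSpace ℂ E]

/-- By the maximum modulus principle, a contractive analytic function whose value at `0` is an
isometry is constant. -/
theorem IsHInfty.eq_zero_of_isometry {Φ : ℂ → E →L[ℂ] E} (hΦ : IsHInfty Φ)
    (hΦ_norm : hInftyNorm Φ ≤ 1) (hΦ_zero : Isometry (Φ 0)) (z : 𝔻) : Φ z = Φ 0 := by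
  ext x
  have hd : DifferentiableOn ℂ (fun w => Φ w x) (ball 0 1) :=
    hΦ.1.clm_apply (differentiableOn_const x)
  have h0 : ‖Φ 0 x‖ = ‖x‖ := (AddMonoidHomClass.isometry_iff_norm (Φ 0)).1 hΦ_zero x
  have hmax : IsMaxOn (norm ∘ fun w => Φ w x) (ball 0 1) 0 := fun w hw => by
    have h := (Φ w).le_of_opNorm_le
      ((hΦ.norm_le (Complex.UnitDisc.mk w (mem_ball_zero_iff.1 hw))).trans hΦ_norm) x
    simpa [h0] using h
  -- Strict convexity is a notion over `ℝ`. It upgrades the maximum principle from constancy of the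
  -- norm to constancy of the function.
  let _ : InnerProductSpace ℝ E := InnerProductSpace.rclikeToReal ℂ E
  have : StrictConvexSpace ℝ E := inferInstance
  exact Complex.eqOn_of_isPreconnected_of_isMaxOn_norm (convex_ball (0 : ℂ) 1).isPreconnected
    isOpen_ball hd (mem_ball_self one_pos) hmax (mem_ball_zero_iff.2 z.norm_lt_one)

/-- As `Φ` is constant on the disc, multiplication by it acts on Taylor coefficients one at a time,
through the isometry `Φ 0`. -/
theorem norm_mulOp_apply_of_isometry [CompleteSpace E] {Φ : ℂ → E →L[ℂ] E} (hΦ : IsHInfty Φ)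
    (hΦ_norm : hInftyNorm Φ ≤ 1) (hΦ_zero : Isometry (Φ 0)) (f : HardySpace E) :
    ‖mulOp Φ hΦ f‖ = ‖f‖ := by
  have hc : (mulOp Φ hΦ f).coeff = fun n => Φ 0 (f.coeff n) := HardySpace.coeff_eq fun z => by
    rw [mulOp_apply, hΦ.eq_zero_of_isometry hΦ_norm hΦ_zero]
    simpa using (f.hasSum_coeff z).mapL (Φ 0)
  rw [← sq_eq_sq₀ (norm_nonneg _) (norm_nonneg _), HardySpace.norm_sq_eq_tsum,
    HardySpace.norm_sq_eq_tsum, hc]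
  simp only [(AddMonoidHomClass.isometry_iff_norm (Φ 0)).1 hΦ_zero]

end Multiplication

theorem proposition4p2 {E : Type*} [NormedAddCommGroup E] [InnerProductSpace ℂ E]
    [CompleteSpace E] (Φ : ℂ → E →L[ℂ] E) (hΦ : IsHInfty Φ) (hΦ_norm : hInftyNorm Φ ≤ 1)
    (hΦ_zero : Isometry (Φ 0)) :
    (HasUnitaryPart (mulOp Φ hΦ) ∨ IsCDotZeroContraction (mulOp Φ hΦ)) ∧
      ¬ (HasUnitaryPart (mulOp Φ hΦ) ∧ IsCDotZeroContraction (mulOp Φ hΦ)) := by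
  have hT := norm_mulOp_apply_of_isometry hΦ hΦ_norm hΦ_zero
  exact ⟨hasUnitaryPart_or_isCDotZeroContraction hT,
    fun h => not_isCDotZeroContraction_of_hasUnitaryPart hT h.1 h.2⟩
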